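/- Let $\mathcal X,\mathcal Y$ be measurable spaces, $\mathcal H$ a real Hilbert space, $\phi:\mathcal X\to\mathcal H$ a (strongly measurable) feature map with kernel $\kappa(x,x')=\langle\phi(x),\phi(x')\rangle$, and $K\in\mathbb N$. A weight $W=[w_1,\dots,w_K]\in\mathcal H^K$ has trace norm $\|W\|_*=\operatorname{tr}\sqrt{W^\top W}$ (the sum of its singular values, $W^\top W$ being the $K\times K$ matrix $(\langle w_j,w_k\rangle)_{j,k}$). Let $\mathcal W\subseteq\mathcal H^K$ be a nonempty set of weights with $B:=\sup_{W\in\mathcal W}\|W\|_*<\infty$, and let $$H_\kappa=\{x\mapsto f_W(x)=(\langle w_1,\phi(x)\rangle,\dots,\langle w_K,\phi(x)\rangle)\in\mathbb R^K : W\in\mathcal W\}.$$ For $x_1,\dots,x_n\in\mathcal X$ ($n\ge1$) let $$\widehat{\mathcal R}(H_\kappa)=\frac1n\,\mathbb E_\xi\Big[\sup_{f\in H_\kappa}\sum_{i=1}^n\sum_{k=1}^K\xi_{ik}[f(x_i)]_k\Big],$$ where the $\xi_{ik}$ are $n\times K$ independent Rademacher variables (uniform on $\{-1,1\}$). There is an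 absolute constant $C>0$ such that, in every such setting, the following two statements hold. (1) Excess risk. Let $\rho$ be a probability measure on $\mathcal X\times\mathcal Y$ and $\ell:\mathbb R^K\times\mathcal Y\to\mathbb R$ a measurable loss such that $\ell(\cdot,y)$ is $L$-Lipschitz for the $2$-norm on $\mathbb R^K$ for every $y$. Assume that $\mathcal E(f)=\int\ell(f(x),y)\,d\rho(x,y)$ is well defined (the integrand is integrable) for every $f\in H_\kappa$, and that the loss has bounded range along $H_\kappa$, in the sense that for some $M$ and $\rho$-almost every $(x,y)$, $|\ell(f(x),y)-\ell(g(x),y)|\le M$ for all $f,g\in H_\kappa$ (for instance $\ell$ takes values in an interval of length $M$; or $\kappa(x,x)\le r^2$ and $M=2LBr$). Let $f^*\in H_\kappa$ minimize $\mathcal E$ over $H_\kappa$. Then for all $n\ge1$ and $0<\delta<1$, with probability at least $1-\delta$ over an i.i.d. sample $(x_1,y_1),\dots,(x_n,y_n)\sim\rho$, every minimizer $\widehat f_n\in H_\kappa$ of the empirical loss $\frac1n\sum_{i=1}^n\ell(f(x_i),y_i)$ over $H_\kappa$ satisfies $$\mathcal E(\widehat f_n)-\mathcal E(f^*)\le 4\sqrt2\,L\,\widehat{\mathcal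 R}(H_\kappa)+C\,M\sqrt{\frac{\log(1/\delta)}{n}},$$ with $\widehat{\mathcal R}(H_\kappa)$ taken on the inputs $x_1,\dots,x_n$ of the sample. (2) Complexity. For every $n\ge1$ and all $x_1,\dots,x_n\in\mathcal X$, $$\widehat{\mathcal R}(H_\kappa)\le\frac Bn\sqrt{K\sum_{i=1}^n\kappa(x_i,x_i)}.$$ -/

import Mathlib

open MeasureTheory
open scoped NNReal BigOperators

noncomputable section

/-- The trace (nuclear) norm `tr √(Wᵀ W)` of a `K`-column weight `W = [w₁, …, w_K] ∈ H^K`: the sum of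
its singular values, i.e. of the square roots of the eigenvalues of the `K × K` matrix `Wᵀ W`, whose
entries are the inner products `⟪w_j, w_k⟫`. -/
def traceNorm {H : Type*} [NormedAddCommGroup H] [InnerProductSpace ℝ H] {K : ℕ}
    (W : Fin K → H) : ℝ :=
  ∑ k : Fin K, Real.sqrt ((Matrix.isHermitian_gram ℝ W).eigenvalues k)

/-- The estimator `x ↦ ⟨W, φ(x)⟩ = (⟪w₁, φ x⟫, …, ⟪w_K, φ x⟫) ∈ ℝ^K` with weight `W`. -/
def linearEstimator {X H : Type*} [NormedAddCommGroup H] [InnerProductSpace ℝ H] {K : ℕ}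
    (φ : X → H) (W : Fin K → H) : X → EuclideanSpace ℝ (Fin K) :=
  fun x => WithLp.toLp 2 (fun k => inner ℝ (W k) (φ x))

/-- The hypothesis space `H_κ` of the estimators whose weight lies in the set `𝒲`. -/
def hypothesisSpace {X H : Type*} [NormedAddCommGroup H] [InnerProductSpace ℝ H] {K : ℕ}
    (φ : X → H) (𝒲 : Set (Fin K → H)) : Set (X → EuclideanSpace ℝ (Fin K)) :=
  linearEstimator φ '' 𝒲

/-- The bound `B = sup ‖W‖_*` over the weights of the estimators in the hypothesis space. -/
def weightBound {H : Type*} [NormedAddCommGroup H] [InnerProductSpace ℝ H] {K : ℕ}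
    (𝒲 : Set (Fin K → H)) : ℝ :=
  sSup (traceNorm '' 𝒲)

/-- The empirical Rademacher complexity
`(1/n) 𝔼_ξ sup_{f ∈ F} ∑ᵢ ∑ₖ ξᵢₖ [f(xᵢ)]ₖ` of a class `F` on the points `x₁, …, xₙ`. The `ξᵢₖ` are
`n × K` independent uniform signs, so `𝔼_ξ` is the uniform average over all sign arrays. -/
def empiricalRademacher {X : Type*} {K n : ℕ} (F : Set (X → EuclideanSpace ℝ (Fin K)))
    (x : Fin n → X) : ℝ :=
  1 / (n : ℝ) * Finset.expect (Finset.univ : Finset (Fin n → Fin K → ℤˣ))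
    (fun ξ => ⨆ f : F, ∑ i, ∑ k, ((ξ i k : ℤ) : ℝ) * f.1 (x i) k)

/-- The expected loss `ℰ(f) = ∫ ℓ(f(x), y) dρ(x, y)`. -/
def expectedLoss {X Y : Type*} [MeasurableSpace X] [MeasurableSpace Y] {K : ℕ}
    (ℓ : EuclideanSpace ℝ (Fin K) → Y → ℝ) (ρ : Measure (X × Y))
    (f : X → EuclideanSpace ℝ (Fin K)) : ℝ :=
  ∫ z, ℓ (f z.1) z.2 ∂ρ

/-- The empirical loss `(1/n) ∑ᵢ ℓ(f(xᵢ), yᵢ)` on the sample `D = ((x₁, y₁), …, (xₙ, yₙ))`. -/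
def empiricalLoss {X Y : Type*} {K n : ℕ}
    (ℓ : EuclideanSpace ℝ (Fin K) → Y → ℝ) (D : Fin n → X × Y)
    (f : X → EuclideanSpace ℝ (Fin K)) : ℝ :=
  1 / (n : ℝ) * ∑ i, ℓ (f (D i).1) (D i).2

/-- `f` minimizes `J` over the class `F`. -/
def IsMinimizer {α : Type*} (J : α → ℝ) (F : Set α) (f : α) : Prop :=
  f ∈ F ∧ ∀ g ∈ F, J f ≤ J g

end

/-!
Excess risk and Rademacher complexity for trace-norm bounded weights.

**Excess risk.** For an empirical minimizer the excess risk is at most the largest one-sided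
deviation `sup_f (𝔼 h_f - (1/n) ∑ h_f(z_i))` of the excess losses `h_f = ℓ(f) - ℓ(f*)`. Subtract
from it twice the empirical Rademacher average of the excess losses. The difference changes by at
most `6 M / n` when one sample point changes, and by symmetrization (`integral_deviationSup_le`) its
mean is at most `0`. A single application of McDiarmid's inequality
(`hasSubgaussianMGF_of_bounded_differences`) therefore gives the deviation term
`3 √2 M √(log (1/δ) / n)` for every `δ < 1`, without a union bound
(`exists_uniform_deviation_event`).

Maurer's vector contraction inequality (`expect_iSup_le_vector_contraction`) bounds the Rademacher
average of the losses by `√2 L` times that of the vector-valued class. Its constant `√2` is the one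
of Khintchine's inequality `‖v‖ ≤ √2 𝔼 |∑ ξ_k v_k|` (`norm_le_sqrt_two_mul_expect_abs`), which
follows from a spectral gap on the sign cube. This gives the factor `2 √2 L` on the complexity, and
the complexity is nonnegative, so the factor `4 √2 L` holds as well.

Suprema over the hypothesis space are made measurable by passing to a countable subfamily that is
dense for pointwise convergence (`exists_countable_pointwise_dense`); strong measurability of the
feature map is what provides it.

**Complexity.** The signed sum is the inner product in `H^K` of `W` with `∑ ξ_{ik} φ(x_i) ⊗ e_k`.
The Hilbert–Schmidt norm of `W` is at most its trace norm, and the second moment of the Rademacher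
sum is `K ∑ κ(x_i, x_i)`.
-/

/-! ### Fourier analysis on the sign cube -/

/-- The Walsh function `ξ ↦ ∏ i ∈ S, ξ i` on the sign cube `ι → ℤˣ`. -/
def walsh {ι : Type*} (S : Finset ι) (ξ : ι → ℤˣ) : ℝ := ∏ i ∈ S, ((ξ i : ℤ) : ℝ)

/-- The Fourier–Walsh coefficient `𝔼_ξ f(ξ) walsh S ξ` of `f`, for uniform `ξ`. -/
noncomputable def walshCoeff {ι : Type*} [Fintype ι] [DecidableEq ι] (f : (ι → ℤˣ) → ℝ)
    (S : Finset ι) : ℝ := 𝔼 ξ, f ξ * walsh S ξ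

/-- The point of the sign cube obtained from `ξ` by changing its `i`-th sign. -/
def flipSign {ι : Type*} [DecidableEq ι] (i : ι) (ξ : ι → ℤˣ) : ι → ℤˣ :=
  Pi.mulSingle i (-1) * ξ

lemma walsh_neg {ι : Type*} (S : Finset ι) (ξ : ι → ℤˣ) :
    walsh S (-ξ) = (-1) ^ S.card * walsh S ξ := by
  simp [walsh, Finset.prod_neg]

section Cube

variable {ι : Type*} [DecidableEq ι]

lemma flipSign_apply_self (i : ι) (ξ : ι → ℤˣ) : flipSign i ξ i = -ξ i := by
  simp [flipSign]

lemma flipSign_apply_of_ne {i j : ι} (h : j ≠ i) (ξ : ι → ℤˣ) : flipSign i ξ j = ξ j := by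
  simp [flipSign, h]

lemma flipSign_flipSign (i : ι) (ξ : ι → ℤˣ) : flipSign i (flipSign i ξ) = ξ := by
  rw [flipSign, flipSign, ← mul_assoc, ← Pi.mulSingle_mul]
  simp

lemma coe_sign_mul_self (u : ℤˣ) : ((u : ℤ) : ℝ) * ((u : ℤ) : ℝ) = 1 := by
  rcases Int.units_eq_one_or u with h | h <;> simp [h]

lemma abs_sign (u : ℤˣ) : |((u : ℤ) : ℝ)| = 1 := by
  rcases Int.units_eq_one_or u with h | h <;> simp [h]

lemma walsh_flipSign (S : Finset ι) (i : ι) (ξ : ι → ℤˣ) :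
    walsh S (flipSign i ξ) = (if i ∈ S then -1 else 1) * walsh S ξ := by
  unfold walsh
  split_ifs with h
  · rw [← Finset.mul_prod_erase S _ h, ← Finset.mul_prod_erase S (fun i => ((ξ i : ℤ) : ℝ)) h,
      flipSign_apply_self, Finset.prod_congr rfl fun j hj => by
        rw [flipSign_apply_of_ne (Finset.ne_of_mem_erase hj)]]
    push_cast
    ring
  · rw [one_mul]
    refine Finset.prod_congr rfl fun j hj => ?_
    rw [flipSign_apply_of_ne (by rintro rfl; exact h hj)]

variable [Fintype ι]

lemma expect_flipSign (i : ι) (f : (ι → ℤˣ) → ℝ) : 𝔼 ξ, f (flipSign i ξ) = 𝔼 ξ, f ξ :=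
  Fintype.expect_equiv (Equiv.mulLeft (Pi.mulSingle i (-1))) _ _ fun _ => rfl

lemma sum_walsh_mul_walsh (ξ η : ι → ℤˣ) :
    ∑ S, walsh S ξ * walsh S η = if ξ = η then (Fintype.card (ι → ℤˣ) : ℝ) else 0 := by
  have h : ∑ S, walsh S ξ * walsh S η = ∏ i, (1 + ((ξ i : ℤ) : ℝ) * ((η i : ℤ) : ℝ)) := by
    rw [Finset.prod_one_add, Finset.powerset_univ]
    exact Finset.sum_congr rfl fun S _ => by simp [walsh, Finset.prod_mul_distrib]
  rw [h]
  split_ifs with he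
  · subst he
    simp only [coe_sign_mul_self]
    norm_num
  · obtain ⟨i, hi⟩ := Function.ne_iff.mp he
    refine Finset.prod_eq_zero (Finset.mem_univ i) ?_
    rcases Int.units_eq_one_or (ξ i) with h1 | h1 <;>
      rcases Int.units_eq_one_or (η i) with h2 | h2 <;> simp_all

/-- Parseval's identity on the sign cube. -/
lemma sum_walshCoeff_mul (f g : (ι → ℤˣ) → ℝ) :
    ∑ S, walshCoeff f S * walshCoeff g S = 𝔼 ξ, f ξ * g ξ := by
  have h1 : ∀ S, walshCoeff f S * walshCoeff g S
      = 𝔼 ξ, 𝔼 η, f ξ * g η * (walsh S ξ * walsh S η) := fun S => by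
    rw [walshCoeff, walshCoeff, Finset.expect_mul_expect]
    exact Finset.expect_congr rfl fun ξ _ => Finset.expect_congr rfl fun η _ => by ring
  simp only [h1]
  rw [← Finset.expect_sum_comm]
  refine Finset.expect_congr rfl fun ξ _ => ?_
  rw [← Finset.expect_sum_comm]
  simp only [← Finset.mul_sum, sum_walsh_mul_walsh, Fintype.expect_eq_sum_div_card, mul_ite,
    mul_zero, Finset.sum_ite_eq, Finset.mem_univ, if_true]
  field_simp

lemma walshCoeff_flipSign (f : (ι → ℤˣ) → ℝ) (i : ι) (S : Finset ι) :
    walshCoeff (fun ξ => f (flipSign i ξ)) S = (if i ∈ S then -1 else 1) * walshCoeff f S := by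
  rw [walshCoeff, ← expect_flipSign i, walshCoeff, Finset.mul_expect]
  refine Finset.expect_congr rfl fun ξ _ => ?_
  rw [flipSign_flipSign, walsh_flipSign]
  ring

lemma walshCoeff_eq_zero_of_even {f : (ι → ℤˣ) → ℝ} (hf : ∀ ξ, f (-ξ) = f ξ) {S : Finset ι}
    (hS : S.card = 1) : walshCoeff f S = 0 := by
  have h : walshCoeff f S = -walshCoeff f S := by
    conv_lhs => rw [walshCoeff, ← Fintype.expect_equiv (Equiv.neg _)
      (fun ξ => f (-ξ) * walsh S (-ξ)) (fun ξ => f ξ * walsh S ξ) fun _ => rfl]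
    rw [walshCoeff, ← Finset.expect_neg_distrib]
    exact Finset.expect_congr rfl fun ξ _ => by rw [hf, walsh_neg, hS]; ring
  linarith

/-- The spectral gap of even functions on the sign cube. The operator
`f ↦ ∑ i, (f - f ∘ flipSign i)` multiplies the coefficient at `S` by `2 |S|`, and the coefficients
of an even function at singletons vanish. -/
lemma variance_le_of_even {f : (ι → ℤˣ) → ℝ} (hf : ∀ ξ, f (-ξ) = f ξ) :
    4 * (𝔼 ξ, f ξ ^ 2 - (𝔼 ξ, f ξ) ^ 2) ≤ 𝔼 ξ, f ξ * ∑ i, (f ξ - f (flipSign i ξ)) := by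
  have h1 : 𝔼 ξ, f ξ * ∑ i, (f ξ - f (flipSign i ξ))
      = ∑ S, 2 * (S.card : ℝ) * walshCoeff f S ^ 2 := by
    have h2 : ∀ i, 𝔼 ξ, f ξ * (f ξ - f (flipSign i ξ))
        = ∑ S, (if i ∈ S then 2 else 0) * walshCoeff f S ^ 2 := fun i => by
      simp only [mul_sub, Finset.expect_sub_distrib]
      rw [← sum_walshCoeff_mul, ← sum_walshCoeff_mul f (fun ξ => f (flipSign i ξ)),
        ← Finset.sum_sub_distrib]
      refine Finset.sum_congr rfl fun S _ => ?_
      rw [walshCoeff_flipSign]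
      split_ifs <;> ring
    simp only [Finset.mul_sum]
    rw [Finset.expect_sum_comm]
    simp only [h2]
    rw [Finset.sum_comm]
    refine Finset.sum_congr rfl fun S _ => ?_
    rw [← Finset.sum_mul]
    congr 1
    simp [mul_comm]
  have h3 : 𝔼 ξ, f ξ ^ 2 - (𝔼 ξ, f ξ) ^ 2
      = ∑ S, (if S = ∅ then 0 else 1) * walshCoeff f S ^ 2 := by
    have h4 : 𝔼 ξ, f ξ = walshCoeff f ∅ := by simp [walshCoeff, walsh]
    have h5 : 𝔼 ξ, f ξ ^ 2 = ∑ S, walshCoeff f S ^ 2 := by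
      simp only [pow_two, sum_walshCoeff_mul]
    rw [h4, h5, ← Finset.add_sum_erase _ _ (Finset.mem_univ ∅),
      ← Finset.add_sum_erase _ (fun S => (if S = ∅ then (0 : ℝ) else 1) * walshCoeff f S ^ 2)
        (Finset.mem_univ ∅), add_sub_cancel_left]
    rw [if_pos rfl, zero_mul, zero_add]
    exact Finset.sum_congr rfl fun S hS => by rw [if_neg (Finset.ne_of_mem_erase hS), one_mul]
  rw [h1, h3, Finset.mul_sum]
  refine Finset.sum_le_sum fun S _ => ?_
  rcases Nat.lt_or_ge S.card 2 with hS | hS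
  · interval_cases hc : S.card
    · rw [Finset.card_eq_zero] at hc
      simp [hc]
    · simp [walshCoeff_eq_zero_of_even hf hc]
  · have hS' : (2 : ℝ) ≤ S.card := by exact_mod_cast hS
    have hne : S ≠ ∅ := by rintro rfl; simp at hS
    rw [if_neg hne, one_mul]
    nlinarith [mul_le_mul_of_nonneg_right hS' (sq_nonneg (walshCoeff f S))]

/-! ### Moments of Rademacher sums -/

lemma expect_sign_mul_sign (i j : ι) :
    𝔼 ξ : ι → ℤˣ, ((ξ i : ℤ) : ℝ) * ((ξ j : ℤ) : ℝ) = if i = j then 1 else 0 := by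
  split_ifs with h
  · subst h
    simp only [coe_sign_mul_self, Fintype.expect_const]
  · have := expect_flipSign i fun ξ : ι → ℤˣ => ((ξ i : ℤ) : ℝ) * ((ξ j : ℤ) : ℝ)
    simp only [flipSign_apply_self, flipSign_apply_of_ne (Ne.symm h)] at this
    push_cast at this
    simp only [neg_mul, Finset.expect_neg_distrib] at this
    linarith

lemma expect_norm_sq_sum_sign_smul {E : Type*} [NormedAddCommGroup E] [InnerProductSpace ℝ E]
    (v : ι → E) :
    𝔼 ξ : ι → ℤˣ, ‖∑ i, ((ξ i : ℤ) : ℝ) • v i‖ ^ 2 = ∑ i, ‖v i‖ ^ 2 := by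
  have h : ∀ ξ : ι → ℤˣ, ‖∑ i, ((ξ i : ℤ) : ℝ) • v i‖ ^ 2
      = ∑ i, ∑ j, ((ξ i : ℤ) : ℝ) * ((ξ j : ℤ) : ℝ) * inner ℝ (v i) (v j) := fun ξ => by
    rw [← real_inner_self_eq_norm_sq, sum_inner]
    refine Finset.sum_congr rfl fun i _ => ?_
    rw [inner_sum]
    refine Finset.sum_congr rfl fun j _ => ?_
    rw [real_inner_smul_left, real_inner_smul_right]
    ring
  simp only [h]
  rw [Finset.expect_sum_comm]
  refine Finset.sum_congr rfl fun i _ => ?_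
  rw [Finset.expect_sum_comm]
  simp only [← Finset.expect_mul, expect_sign_mul_sign, ite_mul, one_mul, zero_mul,
    Finset.sum_ite_eq, Finset.mem_univ, if_true, real_inner_self_eq_norm_sq]

/-- Jensen's inequality for the square on the sign cube, applied to a Rademacher sum. -/
lemma expect_norm_sum_sign_smul_le {E : Type*} [NormedAddCommGroup E] [InnerProductSpace ℝ E]
    (v : ι → E) :
    𝔼 ξ : ι → ℤˣ, ‖∑ i, ((ξ i : ℤ) : ℝ) • v i‖ ≤ √(∑ i, ‖v i‖ ^ 2) := by
  refine Real.le_sqrt_of_sq_le ?_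
  have h := Finset.expect_mul_sq_le_sq_mul_sq Finset.univ
    (fun ξ : ι → ℤˣ => ‖∑ i, ((ξ i : ℤ) : ℝ) • v i‖) fun _ => 1
  simp only [mul_one, one_pow, Fintype.expect_const] at h
  rwa [expect_norm_sq_sum_sign_smul] at h

/-- Khintchine's inequality with the sharp constant `√2` (Szarek), by the argument of Latała and
Oleszkiewicz: `f ξ = |∑ i, ξ i v i|` is even and satisfies `∑ i, (f - f ∘ flipSign i) ≤ 2 f`, so the
spectral gap of even functions bounds `𝔼 f²` by `2 (𝔼 f)²`. -/
theorem norm_le_sqrt_two_mul_expect_abs (v : EuclideanSpace ℝ ι) :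
    ‖v‖ ≤ √2 * 𝔼 ξ : ι → ℤˣ, |∑ i, ((ξ i : ℤ) : ℝ) * v i| := by
  set f : (ι → ℤˣ) → ℝ := fun ξ => |∑ i, ((ξ i : ℤ) : ℝ) * v i| with hf
  have hf0 : ∀ ξ, 0 ≤ f ξ := fun ξ => abs_nonneg _
  have heven : ∀ ξ, f (-ξ) = f ξ := fun ξ => by simp [hf]
  have hflip : ∀ ξ i, ∑ j, ((flipSign i ξ j : ℤ) : ℝ) * v j
      = ∑ j, ((ξ j : ℤ) : ℝ) * v j - 2 * (((ξ i : ℤ) : ℝ) * v i) := fun ξ i => by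
    rw [← Finset.add_sum_erase _ _ (Finset.mem_univ i),
      ← Finset.add_sum_erase _ (fun j => ((ξ j : ℤ) : ℝ) * v j) (Finset.mem_univ i),
      flipSign_apply_self, Finset.sum_congr rfl fun j hj => by
        rw [flipSign_apply_of_ne (Finset.ne_of_mem_erase hj)]]
    push_cast
    ring
  have hL : ∀ ξ, ∑ i, (f ξ - f (flipSign i ξ)) ≤ 2 * f ξ := fun ξ => by
    have h1 : ((Fintype.card ι : ℝ) - 2) * f ξ ≤ ∑ i, f (flipSign i ξ) := by
      calc ((Fintype.card ι : ℝ) - 2) * f ξ ≤ |(Fintype.card ι : ℝ) - 2| * f ξ :=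
            mul_le_mul_of_nonneg_right (le_abs_self _) (hf0 ξ)
        _ = |∑ i, ∑ j, ((flipSign i ξ j : ℤ) : ℝ) * v j| := by
            simp only [hflip, hf]
            rw [← abs_mul, Finset.sum_sub_distrib, ← Finset.mul_sum]
            simp only [Finset.sum_const, Finset.card_univ, nsmul_eq_mul]
            ring_nf
        _ ≤ ∑ i, f (flipSign i ξ) := Finset.abs_sum_le_sum_abs _ _
    rw [Finset.sum_sub_distrib]
    simp only [Finset.sum_const, Finset.card_univ, nsmul_eq_mul]
    linarith
  have hsq : 𝔼 ξ, f ξ ^ 2 = ‖v‖ ^ 2 := by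
    have := expect_norm_sq_sum_sign_smul fun i => v i
    simpa [hf, EuclideanSpace.norm_sq_eq] using this
  have hle : 𝔼 ξ, f ξ * ∑ i, (f ξ - f (flipSign i ξ)) ≤ 2 * 𝔼 ξ, f ξ ^ 2 := by
    rw [Finset.mul_expect]
    refine Finset.expect_le_expect fun ξ _ => ?_
    nlinarith [mul_le_mul_of_nonneg_left (hL ξ) (hf0 ξ)]
  have hvar := variance_le_of_even heven
  have hE : 0 ≤ 𝔼 ξ, f ξ := Finset.expect_nonneg fun ξ _ => hf0 ξ
  refine abs_le_of_sq_le_sq' ?_ (by positivity) |>.2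
  rw [mul_pow, Real.sq_sqrt (by norm_num)]
  linarith

end Cube

/-! ### Vector contraction for Rademacher averages -/

lemma expect_unitsInt (g : ℤˣ → ℝ) : 𝔼 e, g e = (g 1 + g (-1)) / 2 := by
  rw [Fintype.expect_eq_sum_div_card, UnitsInt.univ, Finset.sum_pair (by decide),
    Fintype.card_units_int]
  norm_num

lemma expect_fin_succ {n : ℕ} {A : Type*} [Fintype A] (f : (Fin (n + 1) → A) → ℝ) :
    𝔼 ξ, f ξ = 𝔼 a, 𝔼 η : Fin n → A, f (Fin.cons a η) := by
  rw [← Fintype.expect_equiv (Fin.consEquiv fun _ => A) (fun p => f (Fin.cons p.1 p.2)) f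
    fun _ => rfl, ← Finset.univ_product_univ, Finset.expect_product]

lemma abs_sum_sign_mul_le {κ : Type*} [Fintype κ] (ξ : κ → ℤˣ) (u : EuclideanSpace ℝ κ) :
    |∑ k, ((ξ k : ℤ) : ℝ) * u k| ≤ Fintype.card κ * ‖u‖ := by
  calc |∑ k, ((ξ k : ℤ) : ℝ) * u k| ≤ ∑ k, |((ξ k : ℤ) : ℝ) * u k| :=
        Finset.abs_sum_le_sum_abs _ _
    _ ≤ ∑ _k : κ, ‖u‖ := Finset.sum_le_sum fun k _ => by
        rw [abs_mul, abs_sign, one_mul]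
        exact PiLp.norm_apply_le u k
    _ = Fintype.card κ * ‖u‖ := by simp

section Contraction

variable {S κ : Type*} [Nonempty S] [Fintype κ] [DecidableEq κ] {L : ℝ}

/-- The contraction step for one scalar sign. The two suprema over the values of the sign are
taken at independent points `s` and `t`; Khintchine's inequality turns `‖u s - u t‖` into a
Rademacher average, whose absolute value disappears because the supremum over `(s, t)` is
symmetric. -/
lemma expect_iSup_sign_mul_le (hL : 0 ≤ L) {F ψ : S → ℝ} {u : S → EuclideanSpace ℝ κ}
    (hψ : ∀ s t, ψ s - ψ t ≤ L * ‖u s - u t‖) {a b : ℝ} (hF : ∀ s, F s ≤ a) (hu : ∀ s, ‖u s‖ ≤ b) :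
    𝔼 e : ℤˣ, ⨆ s, (F s + ((e : ℤ) : ℝ) * ψ s) ≤
      𝔼 ξ : κ → ℤˣ, ⨆ s, (F s + √2 * L * ∑ k, ((ξ k : ℤ) : ℝ) * u s k) := by
  set T : (κ → ℤˣ) → ℝ := fun ξ => ⨆ s, (F s + √2 * L * ∑ k, ((ξ k : ℤ) : ℝ) * u s k) with hT
  have hbdd : ∀ ξ : κ → ℤˣ,
      BddAbove (Set.range fun s => F s + √2 * L * ∑ k, ((ξ k : ℤ) : ℝ) * u s k) := fun ξ => by
    refine ⟨a + √2 * L * (Fintype.card κ * b), ?_⟩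
    rintro _ ⟨s, rfl⟩
    have h := (le_abs_self _).trans (abs_sum_sign_mul_le ξ (u s))
    have h' : Fintype.card κ * ‖u s‖ ≤ Fintype.card κ * b :=
      mul_le_mul_of_nonneg_left (hu s) (by positivity)
    exact add_le_add (hF s) (mul_le_mul_of_nonneg_left (h.trans h') (by positivity))
  have hle : ∀ ξ s, F s + √2 * L * ∑ k, ((ξ k : ℤ) : ℝ) * u s k ≤ T ξ :=
    fun ξ s => le_ciSup (hbdd ξ) s
  have hneg : 𝔼 ξ, T (-ξ) = 𝔼 ξ, T ξ :=
    Fintype.expect_equiv (Equiv.neg _) _ _ fun _ => rfl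
  have hpair : ∀ s t, (F s + ψ s) + (F t - ψ t) ≤ 2 * 𝔼 ξ, T ξ := fun s t => by
    have h1 : ∀ ξ : κ → ℤˣ,
        F s + F t + √2 * L * |∑ k, ((ξ k : ℤ) : ℝ) * (u s - u t) k| ≤ T ξ + T (-ξ) := fun ξ => by
      have hs := hle ξ s
      have ht := hle ξ t
      have hs' := hle (-ξ) s
      have ht' := hle (-ξ) t
      simp only [Pi.neg_apply, Units.val_neg, Int.cast_neg, neg_mul,
        Finset.sum_neg_distrib] at hs' ht'
      simp only [PiLp.sub_apply, mul_sub, Finset.sum_sub_distrib]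
      rcases abs_cases (∑ k, ((ξ k : ℤ) : ℝ) * u s k - ∑ k, ((ξ k : ℤ) : ℝ) * u t k) with h | h <;>
        rw [h.1] <;> linarith
    have h2 := Finset.expect_le_expect (s := Finset.univ) fun ξ _ => h1 ξ
    rw [Finset.expect_add_distrib _ (fun _ => F s + F t), Fintype.expect_const, ← Finset.mul_expect,
      Finset.expect_add_distrib, hneg] at h2
    have h3 := mul_le_mul_of_nonneg_left (norm_le_sqrt_two_mul_expect_abs (u s - u t)) hL
    have h4 := hψ s t
    linarith
  have hplus : ∀ t, ⨆ s, (F s + ψ s) ≤ 2 * 𝔼 ξ, T ξ - (F t - ψ t) :=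
    fun t => ciSup_le fun s => by linarith [hpair s t]
  have hminus : ⨆ t, (F t - ψ t) ≤ 2 * 𝔼 ξ, T ξ - ⨆ s, (F s + ψ s) :=
    ciSup_le fun t => by linarith [hplus t]
  rw [expect_unitsInt]
  simp only [Units.val_one, Int.cast_one, one_mul, Units.val_neg, Int.cast_neg, neg_mul,
    ← sub_eq_add_neg]
  linarith

/-- Maurer's vector contraction inequality: replacing Lipschitz images `ψ i` of vectors `u i` by
the vectors themselves, with one sign for each coordinate, loses a factor `√2 L`. The function `F`
carries the terms already treated in the induction. -/
theorem expect_iSup_le_vector_contraction (hL : 0 ≤ L) {n : ℕ} {F : S → ℝ} {ψ : Fin n → S → ℝ}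
    {u : Fin n → S → EuclideanSpace ℝ κ}
    (hψ : ∀ i s t, |ψ i s - ψ i t| ≤ L * ‖u i s - u i t‖) {a : ℝ} {b c : Fin n → ℝ}
    (hF : ∀ s, F s ≤ a) (hψb : ∀ i s, |ψ i s| ≤ c i) (hu : ∀ i s, ‖u i s‖ ≤ b i) :
    𝔼 ε : Fin n → ℤˣ, ⨆ s, (F s + ∑ i, ((ε i : ℤ) : ℝ) * ψ i s) ≤
      𝔼 ξ : Fin n → κ → ℤˣ, ⨆ s, (F s + √2 * L * ∑ i, ∑ k, ((ξ i k : ℤ) : ℝ) * u i s k) := by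
  induction n generalizing F a with
  | zero => simp
  | succ n ih =>
    rw [expect_fin_succ, expect_fin_succ]
    have h1 : ∀ e : ℤˣ,
        𝔼 η : Fin n → ℤˣ, ⨆ s, (F s + ∑ i, (((Fin.cons e η : Fin (n + 1) → ℤˣ) i : ℤ) : ℝ) * ψ i s)
          ≤ 𝔼 ξ : Fin n → κ → ℤˣ, ⨆ s, ((F s + ((e : ℤ) : ℝ) * ψ 0 s) +
            √2 * L * ∑ i, ∑ k, ((ξ i k : ℤ) : ℝ) * u i.succ s k) := fun e => by
      have h := ih (F := fun s => F s + ((e : ℤ) : ℝ) * ψ 0 s) (ψ := fun i => ψ i.succ)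
        (u := fun i => u i.succ) (a := a + c 0) (fun i => hψ i.succ)
        (fun s => add_le_add (hF s) ((le_abs_self _).trans
          (by rw [abs_mul, abs_sign, one_mul]; exact hψb 0 s)))
        (fun i => hψb i.succ) (fun i => hu i.succ)
      simpa only [Fin.sum_univ_succ, Fin.cons_zero, Fin.cons_succ, add_assoc] using h
    refine (Finset.expect_le_expect fun e _ => h1 e).trans ?_
    rw [Finset.expect_comm, Finset.expect_comm Finset.univ (Finset.univ : Finset (Fin n → κ → ℤˣ))]
    refine Finset.expect_le_expect fun ξ _ => ?_
    have h2 := expect_iSup_sign_mul_le hL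
      (F := fun s => F s + √2 * L * ∑ i, ∑ k, ((ξ i k : ℤ) : ℝ) * u (Fin.succ i) s k) (ψ := ψ 0)
      (u := u 0) (a := a + √2 * L * ∑ i : Fin n, Fintype.card κ * b i.succ) (b := b 0)
      (fun s t => (le_abs_self _).trans (hψ 0 s t))
      (fun s => by
        refine add_le_add (hF s) (mul_le_mul_of_nonneg_left ?_ (by positivity))
        refine Finset.sum_le_sum fun i _ => (le_abs_self _).trans ?_
        exact (abs_sum_sign_mul_le (ξ i) (u i.succ s)).trans
          (mul_le_mul_of_nonneg_left (hu i.succ s) (by positivity)))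
      (hu 0)
    calc 𝔼 e : ℤˣ, ⨆ s, (F s + ((e : ℤ) : ℝ) * ψ 0 s +
          √2 * L * ∑ i, ∑ k, ((ξ i k : ℤ) : ℝ) * u (Fin.succ i) s k)
        = _ := Finset.expect_congr rfl fun e _ => iSup_congr fun s => add_right_comm _ _ _
      _ ≤ _ := h2
      _ = _ := Finset.expect_congr rfl fun η _ => iSup_congr fun s => by
        simp only [Fin.sum_univ_succ, Fin.cons_zero, Fin.cons_succ]
        ring

end Contraction

/-! ### The trace-norm class -/

section TraceNorm

variable {H : Type*} [NormedAddCommGroup H] [InnerProductSpace ℝ H] {K : ℕ}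

lemma traceNorm_nonneg (W : Fin K → H) : 0 ≤ traceNorm W :=
  Finset.sum_nonneg fun _ _ => Real.sqrt_nonneg _

/-- The trace norm dominates the Hilbert–Schmidt norm: the trace of the Gram matrix is the sum of
the squares of the singular values. -/
lemma sum_norm_sq_le_traceNorm_sq (W : Fin K → H) : ∑ k, ‖W k‖ ^ 2 ≤ traceNorm W ^ 2 := by
  have htr : ∑ k, ‖W k‖ ^ 2 = ∑ k, (Matrix.isHermitian_gram ℝ W).eigenvalues k := by
    have h := (Matrix.isHermitian_gram ℝ W).trace_eq_sum_eigenvalues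
    simp only [Matrix.trace, Matrix.diag, Matrix.gram_apply, real_inner_self_eq_norm_sq] at h
    simpa using h
  have hsq : ∑ k, (Matrix.isHermitian_gram ℝ W).eigenvalues k
      = ∑ k, √((Matrix.isHermitian_gram ℝ W).eigenvalues k) ^ 2 :=
    Finset.sum_congr rfl fun k _ =>
      (Real.sq_sqrt ((Matrix.posSemidef_gram ℝ W).eigenvalues_nonneg k)).symm
  rw [htr, hsq]
  exact Finset.sum_sq_le_sq_sum_of_nonneg fun _ _ => Real.sqrt_nonneg _

lemma norm_toLp_le_traceNorm (W : Fin K → H) :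
    ‖(WithLp.toLp 2 W : PiLp 2 fun _ : Fin K => H)‖ ≤ traceNorm W := by
  refine abs_le_of_sq_le_sq' ?_ (traceNorm_nonneg W) |>.2
  rw [PiLp.norm_sq_eq_of_L2]
  exact sum_norm_sq_le_traceNorm_sq W

variable {X : Type*}

lemma norm_linearEstimator_le (φ : X → H) (W : Fin K → H) (x : X) :
    ‖linearEstimator φ W x‖ ≤ traceNorm W * ‖φ x‖ := by
  refine abs_le_of_sq_le_sq' ?_ (mul_nonneg (traceNorm_nonneg W) (norm_nonneg _)) |>.2
  rw [EuclideanSpace.norm_sq_eq, mul_pow]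
  refine le_trans ?_ (mul_le_mul_of_nonneg_right (sum_norm_sq_le_traceNorm_sq W) (sq_nonneg _))
  rw [Finset.sum_mul]
  refine Finset.sum_le_sum fun k _ => ?_
  rw [← mul_pow]
  exact pow_le_pow_left₀ (norm_nonneg _) (norm_inner_le_norm _ _) 2

lemma traceNorm_le_weightBound {𝒲 : Set (Fin K → H)} (hB : BddAbove (traceNorm '' 𝒲))
    {W : Fin K → H} (hW : W ∈ 𝒲) : traceNorm W ≤ weightBound 𝒲 :=
  le_csSup hB ⟨W, hW, rfl⟩

lemma norm_hypothesisSpace_le {φ : X → H} {𝒲 : Set (Fin K → H)} (hB : BddAbove (traceNorm '' 𝒲))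
    {f : X → EuclideanSpace ℝ (Fin K)} (hf : f ∈ hypothesisSpace φ 𝒲) (x : X) :
    ‖f x‖ ≤ weightBound 𝒲 * ‖φ x‖ := by
  obtain ⟨W, hW, rfl⟩ := hf
  exact (norm_linearEstimator_le φ W x).trans
    (mul_le_mul_of_nonneg_right (traceNorm_le_weightBound hB hW) (norm_nonneg _))

/-- Cauchy–Schwarz for the pairing of `W` with the Rademacher sum `∑ ξ_{ik} φ(x_i) ⊗ e_k` in
`H^K`, and the second moment of that sum. -/
theorem empiricalRademacher_hypothesisSpace_le {φ : X → H} {𝒲 : Set (Fin K → H)}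
    (h𝒲 : 𝒲.Nonempty) (hB : BddAbove (traceNorm '' 𝒲)) {n : ℕ} (x : Fin n → X) :
    empiricalRademacher (hypothesisSpace φ 𝒲) x ≤
      weightBound 𝒲 / n * √(K * ∑ i, ‖φ (x i)‖ ^ 2) := by
  obtain ⟨W₀, hW₀⟩ := h𝒲
  have : Nonempty (hypothesisSpace φ 𝒲) := ⟨⟨_, W₀, hW₀, rfl⟩⟩
  have hB0 : 0 ≤ weightBound 𝒲 := (traceNorm_nonneg W₀).trans (traceNorm_le_weightBound hB hW₀)
  let v : Fin n × Fin K → PiLp 2 fun _ : Fin K => H :=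
    fun p => WithLp.toLp 2 (Pi.single p.2 (φ (x p.1)))
  have hv : ∑ p, ‖v p‖ ^ 2 = K * ∑ i, ‖φ (x i)‖ ^ 2 := by
    rw [Fintype.sum_prod_type]
    simp [v, Finset.mul_sum]
  have hsup : ∀ ξ : Fin n → Fin K → ℤˣ,
      ⨆ f : hypothesisSpace φ 𝒲, ∑ i, ∑ k, ((ξ i k : ℤ) : ℝ) * f.1 (x i) k
        ≤ weightBound 𝒲 * ‖∑ p : Fin n × Fin K, ((ξ p.1 p.2 : ℤ) : ℝ) • v p‖ := fun ξ => by
    refine ciSup_le ?_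
    rintro ⟨_, W, hW, rfl⟩
    have h1 : ∑ i, ∑ k, ((ξ i k : ℤ) : ℝ) * linearEstimator φ W (x i) k
        = inner ℝ (WithLp.toLp 2 W : PiLp 2 fun _ : Fin K => H)
          (∑ p : Fin n × Fin K, ((ξ p.1 p.2 : ℤ) : ℝ) • v p) := by
      rw [inner_sum, Fintype.sum_prod_type]
      refine Finset.sum_congr rfl fun i _ => Finset.sum_congr rfl fun k _ => ?_
      rw [real_inner_smul_right, PiLp.inner_apply, Finset.sum_eq_single k]
      · simp [v, linearEstimator]
      · intro j _ hj
        simp [v, hj]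
      · simp
    change ∑ i, ∑ k, ((ξ i k : ℤ) : ℝ) * linearEstimator φ W (x i) k ≤ _
    rw [h1]
    exact (real_inner_le_norm _ _).trans (mul_le_mul_of_nonneg_right
      ((norm_toLp_le_traceNorm W).trans (traceNorm_le_weightBound hB hW)) (norm_nonneg _))
  have hE : 𝔼 ξ : Fin n → Fin K → ℤˣ, ‖∑ p : Fin n × Fin K, ((ξ p.1 p.2 : ℤ) : ℝ) • v p‖
      ≤ √(∑ p, ‖v p‖ ^ 2) := by
    rw [Fintype.expect_equiv (Equiv.curry (Fin n) (Fin K) ℤˣ).symm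
      (fun ξ => ‖∑ p : Fin n × Fin K, ((ξ p.1 p.2 : ℤ) : ℝ) • v p‖)
      (fun ζ : Fin n × Fin K → ℤˣ => ‖∑ p, ((ζ p : ℤ) : ℝ) • v p‖) fun _ => rfl]
    exact expect_norm_sum_sign_smul_le v
  rw [hv] at hE
  calc empiricalRademacher (hypothesisSpace φ 𝒲) x
      ≤ 1 / (n : ℝ) * (weightBound 𝒲 * √(K * ∑ i, ‖φ (x i)‖ ^ 2)) := by
        refine mul_le_mul_of_nonneg_left ?_ (by positivity)
        refine (Finset.expect_le_expect fun ξ _ => hsup ξ).trans ?_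
        rw [← Finset.mul_expect]
        exact mul_le_mul_of_nonneg_left hE hB0
    _ = weightBound 𝒲 / n * √(K * ∑ i, ‖φ (x i)‖ ^ 2) := by ring

end TraceNorm

/-! ### McDiarmid's inequality -/

section McDiarmid

variable {Z : Type*} [MeasurableSpace Z]

lemma integrable_of_abs_le {μ : Measure Z} [IsFiniteMeasure μ] {f : Z → ℝ} (hf : Measurable f)
    {b : ℝ} (hb : ∀ z, |f z| ≤ b) : Integrable f μ :=
  Integrable.of_bound hf.aestronglyMeasurable b (.of_forall hb)

variable (ρ : Measure Z) [IsProbabilityMeasure ρ]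

lemma integral_pi_fin_succ {n : ℕ} {f : (Fin (n + 1) → Z) → ℝ}
    (hf : Integrable f (Measure.pi fun _ => ρ)) :
    Integrable (fun p : Z × (Fin n → Z) => f (Fin.cons p.1 p.2)) (ρ.prod (Measure.pi fun _ => ρ)) ∧
    ∫ D, f D ∂(Measure.pi fun _ => ρ)
      = ∫ z, ∫ D, f (Fin.cons z D) ∂(Measure.pi fun _ : Fin n => ρ) ∂ρ := by
  have hmp := (measurePreserving_piFinSuccAbove (fun _ : Fin (n + 1) => ρ) 0).symm
  have heq : ∀ p : Z × (Fin n → Z),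
      (MeasurableEquiv.piFinSuccAbove (fun _ : Fin (n + 1) => Z) 0).symm p = Fin.cons p.1 p.2 :=
    fun p => by simp [MeasurableEquiv.piFinSuccAbove, Fin.consEquiv]
  have hint : Integrable (fun p : Z × (Fin n → Z) => f (Fin.cons p.1 p.2))
      (ρ.prod (Measure.pi fun _ => ρ)) := by
    have h := (hmp.integrable_comp_emb (MeasurableEquiv.measurableEmbedding _)).mpr hf
    simpa only [Function.comp_def, heq] using h
  refine ⟨hint, ?_⟩
  rw [← hmp.integral_comp', ← integral_prod _ hint]
  simp only [heq]

/-- Bounded differences give sub-Gaussian concentration (McDiarmid). Integrating out all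
coordinates but the first leaves a function with values in an interval of length `c`, to which
Hoeffding's lemma applies; the remaining fluctuation is handled by induction. -/
theorem hasSubgaussianMGF_of_bounded_differences {n : ℕ} {F : (Fin n → Z) → ℝ} (hF : Measurable F)
    {b : ℝ} (hb : ∀ D, |F D| ≤ b) {c : ℝ≥0}
    (hc : ∀ D i z, |F (Function.update D i z) - F D| ≤ c) :
    ProbabilityTheory.HasSubgaussianMGF
      (fun D => F D - ∫ D', F D' ∂(Measure.pi fun _ => ρ)) (n * (c / 2) ^ 2)
      (Measure.pi fun _ => ρ) := by
  have hexp_bdd : ∀ t x m : ℝ, |x| ≤ b → |Real.exp (t * (x - m))| ≤ Real.exp (|t| * (b + |m|)) :=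
    fun t x m hx => by
      rw [Real.abs_exp]
      refine Real.exp_le_exp.mpr ((le_abs_self _).trans ?_)
      rw [abs_mul]
      refine mul_le_mul_of_nonneg_left ?_ (abs_nonneg t)
      exact (abs_sub _ _).trans (add_le_add_left hx _)
  refine ⟨fun t => integrable_of_abs_le ((hF.sub_const _).const_mul t).exp
    fun D => hexp_bdd t _ _ (hb D), fun t => ?_⟩
  induction n with
  | zero =>
    have hconst : ∀ D : Fin 0 → Z, F D = F default := fun D => congrArg F (Subsingleton.elim _ _)
    simp [ProbabilityTheory.mgf, hconst]
  | succ n ih =>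
    have hcons : Measurable fun p : Z × (Fin n → Z) => (Fin.cons p.1 p.2 : Fin (n + 1) → Z) :=
      measurable_pi_lambda _ fun i => by
        refine Fin.cases ?_ (fun j => ?_) i
        · simpa using measurable_fst
        · simpa [Function.comp_def] using (measurable_pi_apply j).comp measurable_snd
    have hcons' : ∀ z, Measurable fun D : Fin n → Z => (Fin.cons z D : Fin (n + 1) → Z) :=
      fun z => hcons.comp measurable_prodMk_left
    set μ : Measure (Fin n → Z) := Measure.pi fun _ => ρ with hμ
    set g : Z → ℝ := fun z => ∫ D, F (Fin.cons z D) ∂μ with hg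
    have hgm : Measurable g :=
      ((hF.comp hcons).stronglyMeasurable.integral_prod_right' (ν := μ)).measurable
    have hFint : ∀ z, Integrable (fun D => F (Fin.cons z D)) μ :=
      fun z => integrable_of_abs_le (hF.comp (hcons' z)) fun D => hb _
    have hgb : ∀ z, |g z| ≤ b := fun z => by
      have h := norm_integral_le_of_norm_le_const (μ := μ) (f := fun D => F (Fin.cons z D))
        (C := b) (.of_forall fun D => hb _)
      simpa using h
    have hgc : ∀ z z', g z ≤ g z' + c := fun z z' => by
      have h : g z ≤ ∫ D, (F (Fin.cons z' D) + c) ∂μ := by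
        refine integral_mono (hFint z) ((hFint z').add (integrable_const _)) fun D => ?_
        have h' := hc (Fin.cons z' D) 0 z
        rw [Fin.update_cons_zero] at h'
        linarith [le_abs_self (F (Fin.cons z D) - F (Fin.cons z' D))]
      rwa [integral_add (hFint z') (integrable_const _), integral_const, probReal_univ,
        one_smul] at h
    have : Nonempty Z := nonempty_of_isProbabilityMeasure ρ
    have hbelow : BddBelow (Set.range g) :=
      ⟨-b, by rintro _ ⟨z, rfl⟩; exact (abs_le.mp (hgb z)).1⟩
    have hgmem : ∀ z, g z ∈ Set.Icc (⨅ z', g z') ((⨅ z', g z') + c) := fun z => by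
      refine ⟨ciInf_le hbelow z, ?_⟩
      have : g z - c ≤ ⨅ z', g z' := le_ciInf fun z' => by linarith [hgc z z']
      linarith
    have hsub := ProbabilityTheory.hasSubgaussianMGF_of_mem_Icc (μ := ρ) hgm.aemeasurable
      (.of_forall hgmem)
    rw [add_sub_cancel_left, NNReal.nnnorm_eq] at hsub
    have hFint' : Integrable F (Measure.pi fun _ : Fin (n + 1) => ρ) := integrable_of_abs_le hF hb
    set m : ℝ := ∫ D', F D' ∂(Measure.pi fun _ : Fin (n + 1) => ρ) with hm
    have hmg : m = ∫ z, g z ∂ρ := (integral_pi_fin_succ ρ hFint').2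
    obtain ⟨hI1, hI2⟩ := integral_pi_fin_succ ρ
      (f := fun D => Real.exp (t * (F D - m))) (integrable_of_abs_le
        ((hF.sub_const _).const_mul t).exp fun D => hexp_bdd t _ _ (hb D))
    rw [ProbabilityTheory.mgf, hI2]
    calc ∫ z, ∫ D, Real.exp (t * (F (Fin.cons z D) - m)) ∂μ ∂ρ
        ≤ ∫ z, Real.exp (n * (c / 2) ^ 2 * t ^ 2 / 2) * Real.exp (t * (g z - m)) ∂ρ := by
          refine integral_mono hI1.integral_prod_left ?_ fun z => ?_
          · exact (integrable_of_abs_le ((hgm.sub_const _).const_mul t).exp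
              fun z => hexp_bdd t _ _ (hgb z)).const_mul _
          · have hz := ih (F := fun D => F (Fin.cons z D)) (hF.comp (hcons' z)) (fun D => hb _)
              (fun D i z' => by
                simp only [Fin.cons_update]
                exact hc _ _ _)
            have hsplit : ∀ D, Real.exp (t * (F (Fin.cons z D) - m))
                = Real.exp (t * (F (Fin.cons z D) - g z)) * Real.exp (t * (g z - m)) := fun D => by
              rw [← Real.exp_add]
              ring_nf
            simp only [hsplit]
            rw [integral_mul_const]
            refine mul_le_mul_of_nonneg_right ?_ (Real.exp_nonneg _)
            simpa [ProbabilityTheory.mgf] using hz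
      _ ≤ Real.exp (n * (c / 2) ^ 2 * t ^ 2 / 2) * Real.exp ((c / 2) ^ 2 * t ^ 2 / 2) := by
          rw [integral_const_mul]
          refine mul_le_mul_of_nonneg_left ?_ (Real.exp_nonneg _)
          have h := hsub.mgf_le t
          simp only [ProbabilityTheory.mgf, ← hmg] at h
          simpa using h
      _ = _ := by
          rw [← Real.exp_add]
          push_cast
          ring_nf

end McDiarmid

/-! ### Symmetrization and uniform deviation -/

lemma abs_iSup_sub_iSup_le {J : Type*} [Nonempty J] {a b : J → ℝ} (ha : BddAbove (Set.range a))
    (hb : BddAbove (Set.range b)) {c : ℝ} (h : ∀ j, |a j - b j| ≤ c) :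
    |(⨆ j, a j) - ⨆ j, b j| ≤ c := by
  have h1 : ⨆ j, a j ≤ (⨆ j, b j) + c := ciSup_le fun j => by
    linarith [le_ciSup hb j, (abs_le.mp (h j)).2]
  have h2 : ⨆ j, b j ≤ (⨆ j, a j) + c := ciSup_le fun j => by
    linarith [le_ciSup ha j, (abs_le.mp (h j)).1]
  exact abs_le.mpr ⟨by linarith, by linarith⟩

section Symmetrization

variable {J Z : Type*} {n : ℕ} {h : J → Z → ℝ} {M : ℝ}

/-- The supremum over the family `h` of its signed sums `∑ i, ξ i * h j (D i)` on the sample `D`. -/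
noncomputable def signedSup (h : J → Z → ℝ) (ξ : Fin n → ℤˣ) (D : Fin n → Z) : ℝ :=
  ⨆ j, ∑ i, ((ξ i : ℤ) : ℝ) * h j (D i)

/-- The Rademacher average of the family `h` on the sample `D`, not divided by the sample size. -/
noncomputable def rademacherSup (h : J → Z → ℝ) (D : Fin n → Z) : ℝ :=
  𝔼 ξ : Fin n → ℤˣ, signedSup h ξ D

/-- The largest one-sided deviation of the sums of the family `h` on the sample `D` from their
means. -/
noncomputable def deviationSup [MeasurableSpace Z] (ρ : Measure Z) (h : J → Z → ℝ)
    (D : Fin n → Z) : ℝ :=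
  ⨆ j, (n * ∫ z, h j z ∂ρ - ∑ i, h j (D i))

lemma abs_signed_sum_le (hM : ∀ j z, |h j z| ≤ M) (ξ : Fin n → ℤˣ) (D : Fin n → Z) (j : J) :
    |∑ i, ((ξ i : ℤ) : ℝ) * h j (D i)| ≤ n * M := by
  calc |∑ i, ((ξ i : ℤ) : ℝ) * h j (D i)| ≤ ∑ i, |((ξ i : ℤ) : ℝ) * h j (D i)| :=
        Finset.abs_sum_le_sum_abs _ _
    _ ≤ ∑ _i : Fin n, M := Finset.sum_le_sum fun i _ => by
        rw [abs_mul, abs_sign, one_mul]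
        exact hM _ _
    _ = n * M := by simp

lemma abs_signed_sum_update_sub_le (hM : ∀ j z, |h j z| ≤ M) (ξ : Fin n → ℤˣ) (D : Fin n → Z)
    (i : Fin n) (z : Z) (j : J) :
    |∑ k, ((ξ k : ℤ) : ℝ) * h j (Function.update D i z k) - ∑ k, ((ξ k : ℤ) : ℝ) * h j (D k)|
      ≤ 2 * M := by
  rw [← Finset.sum_sub_distrib, Finset.sum_eq_single i]
  · rw [Function.update_self, ← mul_sub, abs_mul, abs_sign, one_mul]
    linarith [abs_sub (h j z) (h j (D i)), hM j z, hM j (D i)]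
  · intro k _ hk
    rw [Function.update_of_ne hk, sub_self]
  · simp

lemma bddAbove_signed_sum (hM : ∀ j z, |h j z| ≤ M) (ξ : Fin n → ℤˣ) (D : Fin n → Z) :
    BddAbove (Set.range fun j => ∑ i, ((ξ i : ℤ) : ℝ) * h j (D i)) :=
  ⟨n * M, by rintro _ ⟨j, rfl⟩; exact (le_abs_self _).trans (abs_signed_sum_le hM ξ D j)⟩

lemma abs_signedSup_le [Nonempty J] (hM : ∀ j z, |h j z| ≤ M) (ξ : Fin n → ℤˣ) (D : Fin n → Z) :
    |signedSup h ξ D| ≤ n * M := by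
  obtain ⟨j⟩ := ‹Nonempty J›
  have hj := (abs_le.mp (abs_signed_sum_le hM ξ D j)).1
  exact abs_le.mpr ⟨hj.trans (le_ciSup (bddAbove_signed_sum hM ξ D) j),
    ciSup_le fun j => (le_abs_self _).trans (abs_signed_sum_le hM ξ D j)⟩

lemma abs_signedSup_update_sub_le [Nonempty J] (hM : ∀ j z, |h j z| ≤ M) (ξ : Fin n → ℤˣ)
    (D : Fin n → Z) (i : Fin n) (z : Z) :
    |signedSup h ξ (Function.update D i z) - signedSup h ξ D| ≤ 2 * M :=
  abs_iSup_sub_iSup_le (bddAbove_signed_sum hM ξ _) (bddAbove_signed_sum hM ξ D)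
    (abs_signed_sum_update_sub_le hM ξ D i z)

lemma abs_rademacherSup_le [Nonempty J] (hM : ∀ j z, |h j z| ≤ M) (D : Fin n → Z) :
    |rademacherSup h D| ≤ n * M :=
  (Finset.abs_expect_le _ _).trans
    (Finset.expect_le Finset.univ_nonempty fun ξ _ => abs_signedSup_le hM ξ D)

lemma abs_rademacherSup_update_sub_le [Nonempty J] (hM : ∀ j z, |h j z| ≤ M)
    (D : Fin n → Z) (i : Fin n) (z : Z) :
    |rademacherSup h (Function.update D i z) - rademacherSup h D| ≤ 2 * M := by
  rw [rademacherSup, rademacherSup, ← Finset.expect_sub_distrib]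
  exact (Finset.abs_expect_le _ _).trans
    (Finset.expect_le Finset.univ_nonempty fun ξ _ => abs_signedSup_update_sub_le hM ξ D i z)

variable [MeasurableSpace Z]

lemma measurable_signedSup [Countable J] (hh : ∀ j, Measurable (h j)) (ξ : Fin n → ℤˣ) :
    Measurable (signedSup h ξ) :=
  Measurable.iSup fun j => Finset.measurable_sum _ fun i _ =>
    ((hh j).comp (measurable_pi_apply i)).const_mul _

lemma measurable_rademacherSup [Countable J] (hh : ∀ j, Measurable (h j)) :
    Measurable (rademacherSup h : (Fin n → Z) → ℝ) := by
  simp only [funext fun D => Fintype.expect_eq_sum_div_card fun ξ => signedSup h ξ D,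
    show (rademacherSup h : (Fin n → Z) → ℝ) = fun D => 𝔼 ξ, signedSup h ξ D from rfl]
  exact (Finset.measurable_sum _ fun ξ _ => measurable_signedSup hh ξ).div_const _

lemma measurable_deviationSup {ρ : Measure Z} [Countable J] (hh : ∀ j, Measurable (h j)) :
    Measurable (deviationSup ρ h : (Fin n → Z) → ℝ) :=
  Measurable.iSup fun j => (Finset.measurable_sum _ fun i _ =>
    (hh j).comp (measurable_pi_apply i)).const_sub _

variable {ρ : Measure Z} [IsProbabilityMeasure ρ]

lemma abs_deviation_le (hM : ∀ j z, |h j z| ≤ M) (D : Fin n → Z) (j : J) :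
    |n * ∫ z, h j z ∂ρ - ∑ i, h j (D i)| ≤ 2 * (n * M) := by
  have h1 : |∫ z, h j z ∂ρ| ≤ M := by
    simpa using norm_integral_le_of_norm_le_const (μ := ρ) (f := h j) (.of_forall fun z => hM j z)
  have h2 : |∑ i, h j (D i)| ≤ n * M := by
    simpa using abs_signed_sum_le hM (1 : Fin n → ℤˣ) D j
  have h3 : |n * ∫ z, h j z ∂ρ| ≤ n * M := by
    rw [abs_mul, Nat.abs_cast]
    exact mul_le_mul_of_nonneg_left h1 (Nat.cast_nonneg n)
  linarith [abs_sub (n * ∫ z, h j z ∂ρ) (∑ i, h j (D i))]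

lemma bddAbove_deviation (hM : ∀ j z, |h j z| ≤ M) (D : Fin n → Z) :
    BddAbove (Set.range fun j => n * ∫ z, h j z ∂ρ - ∑ i, h j (D i)) :=
  ⟨2 * (n * M), by rintro _ ⟨j, rfl⟩; exact (le_abs_self _).trans (abs_deviation_le hM D j)⟩

lemma abs_deviationSup_le [Nonempty J] (hM : ∀ j z, |h j z| ≤ M) (D : Fin n → Z) :
    |deviationSup ρ h D| ≤ 2 * (n * M) := by
  obtain ⟨j⟩ := ‹Nonempty J›
  have hj := (abs_le.mp (abs_deviation_le (ρ := ρ) hM D j)).1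
  exact abs_le.mpr ⟨hj.trans (le_ciSup (bddAbove_deviation hM D) j),
    ciSup_le fun j => (le_abs_self _).trans (abs_deviation_le hM D j)⟩

lemma abs_deviationSup_update_sub_le [Nonempty J] (hM : ∀ j z, |h j z| ≤ M)
    (D : Fin n → Z) (i : Fin n) (z : Z) :
    |deviationSup ρ h (Function.update D i z) - deviationSup ρ h D| ≤ 2 * M := by
  refine abs_iSup_sub_iSup_le (bddAbove_deviation hM _) (bddAbove_deviation hM D) fun j => ?_
  have h1 := abs_signed_sum_update_sub_le hM (1 : Fin n → ℤˣ) D i z j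
  simp only [Pi.one_apply, Units.val_one, Int.cast_one, one_mul] at h1
  rwa [sub_sub_sub_cancel_left, abs_sub_comm]

/-- Exchanging two independent samples in the coordinates where `ξ` is `-1` preserves their joint
law. -/
lemma measurePreserving_exchange (ρ : Measure Z) [IsProbabilityMeasure ρ] (ξ : Fin n → ℤˣ) :
    MeasurePreserving
      (fun p : (Fin n → Z) × (Fin n → Z) =>
        ((fun i => if ξ i = 1 then p.1 i else p.2 i : Fin n → Z),
          (fun i => if ξ i = 1 then p.2 i else p.1 i : Fin n → Z)))
      ((Measure.pi fun _ => ρ).prod (Measure.pi fun _ => ρ))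
      ((Measure.pi fun _ => ρ).prod (Measure.pi fun _ => ρ)) := by
  have he := measurePreserving_arrowProdEquivProdArrow Z Z (Fin n) (fun _ => ρ) fun _ => ρ
  have hmid : MeasurePreserving
      (fun (a : Fin n → Z × Z) i => (if ξ i = 1 then id else Prod.swap : Z × Z → Z × Z) (a i))
      (Measure.pi fun _ => ρ.prod ρ) (Measure.pi fun _ => ρ.prod ρ) :=
    measurePreserving_pi (fun _ : Fin n => ρ.prod ρ) (fun _ => ρ.prod ρ)
      (f := fun i => if ξ i = 1 then id else Prod.swap) fun i => by
      by_cases hi : ξ i = 1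
      · simpa only [hi, if_true] using MeasurePreserving.id _
      · simpa only [hi, if_false] using Measure.measurePreserving_swap
  convert he.comp (hmid.comp he.symm) using 1
  funext p
  refine Prod.ext (funext fun i => ?_) (funext fun i => ?_) <;>
    by_cases hi : ξ i = 1 <;>
    simp [hi, MeasurableEquiv.arrowProdEquivProdArrow, Equiv.arrowProdEquivProdArrow]

/-- Symmetrization. With an independent second sample `D'`, the deviation is at most the
conditional mean of `sup_j ∑ i, (h j (D' i) - h j (D i))`; the law of this supremum does not change
when signs are inserted, and the signed supremum splits into two Rademacher suprema. -/
theorem integral_deviationSup_le [Countable J] [Nonempty J] (hh : ∀ j, Measurable (h j))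
    (hM : ∀ j z, |h j z| ≤ M) :
    ∫ D, deviationSup ρ h D ∂(Measure.pi fun _ : Fin n => ρ) ≤
      2 * ∫ D, rademacherSup h D ∂(Measure.pi fun _ : Fin n => ρ) := by
  set μ : Measure (Fin n → Z) := Measure.pi fun _ => ρ with hμ
  -- For a pair `p` of samples, the supremum of the signed sums of the differences of `h j`.
  let Q : (Fin n → ℤˣ) → (Fin n → Z) × (Fin n → Z) → ℝ :=
    fun ξ p => ⨆ j, ∑ i, ((ξ i : ℤ) : ℝ) * (h j (p.2 i) - h j (p.1 i))
  have hQeq : ∀ ξ p, Q ξ p = ⨆ j, (∑ i, ((ξ i : ℤ) : ℝ) * h j (p.2 i) -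
      ∑ i, ((ξ i : ℤ) : ℝ) * h j (p.1 i)) := fun ξ p => by
    simp only [Q, mul_sub, Finset.sum_sub_distrib]
  have hterm : ∀ (ξ : Fin n → ℤˣ) (p : (Fin n → Z) × (Fin n → Z)) j,
      |∑ i, ((ξ i : ℤ) : ℝ) * h j (p.2 i) - ∑ i, ((ξ i : ℤ) : ℝ) * h j (p.1 i)| ≤ 2 * (n * M) :=
    fun ξ p j => by
      linarith [abs_sub (∑ i, ((ξ i : ℤ) : ℝ) * h j (p.2 i)) (∑ i, ((ξ i : ℤ) : ℝ) * h j (p.1 i)),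
        abs_signed_sum_le hM ξ p.2 j, abs_signed_sum_le hM ξ p.1 j]
  have hQbdd : ∀ (ξ : Fin n → ℤˣ) (p : (Fin n → Z) × (Fin n → Z)), BddAbove (Set.range fun j =>
      ∑ i, ((ξ i : ℤ) : ℝ) * h j (p.2 i) - ∑ i, ((ξ i : ℤ) : ℝ) * h j (p.1 i)) := fun ξ p =>
    ⟨2 * (n * M), by rintro _ ⟨j, rfl⟩; exact (le_abs_self _).trans (hterm ξ p j)⟩
  have hQm : ∀ ξ, Measurable (Q ξ) := fun ξ =>
    Measurable.iSup fun j => Finset.measurable_sum _ fun i _ =>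
      (((hh j).comp ((measurable_pi_apply i).comp measurable_snd)).sub
        ((hh j).comp ((measurable_pi_apply i).comp measurable_fst))).const_mul _
  have hQb : ∀ ξ p, |Q ξ p| ≤ 2 * (n * M) := fun ξ p => by
    rw [hQeq]
    obtain ⟨j⟩ := ‹Nonempty J›
    exact abs_le.mpr ⟨(abs_le.mp (hterm ξ p j)).1.trans (le_ciSup (hQbdd ξ p) j),
      ciSup_le fun j => (le_abs_self _).trans (hterm ξ p j)⟩
  have hQi : ∀ ξ, Integrable (Q ξ) (μ.prod μ) := fun ξ => integrable_of_abs_le (hQm ξ) (hQb ξ)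
  have hSi : ∀ ξ : Fin n → ℤˣ, Integrable (signedSup h ξ) μ := fun ξ =>
    integrable_of_abs_le (measurable_signedSup hh ξ) (abs_signedSup_le hM ξ)
  have hghost : ∫ D, deviationSup ρ h D ∂μ ≤ ∫ p, Q 1 p ∂(μ.prod μ) := by
    rw [integral_prod _ (hQi 1)]
    refine integral_mono (integrable_of_abs_le (measurable_deviationSup hh)
      (abs_deviationSup_le hM)) (hQi 1).integral_prod_left fun D => ciSup_le fun j => ?_
    have hji : ∀ i : Fin n, Integrable (fun D' : Fin n → Z => h j (D' i)) μ := fun i =>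
      integrable_of_abs_le ((hh j).comp (measurable_pi_apply i)) fun D' => hM _ _
    have hmean : ∀ i : Fin n, ∫ D', h j (D' i) ∂μ = ∫ z, h j z ∂ρ := fun i => by
      have hmp := measurePreserving_eval (fun _ : Fin n => ρ) i
      rw [← hmp.map_eq, integral_map hmp.measurable.aemeasurable
        (hh j).aestronglyMeasurable]
    have hlin : n * ∫ z, h j z ∂ρ - ∑ i, h j (D i)
        = ∫ D', (∑ i, h j (D' i) - ∑ i, h j (D i)) ∂μ := by
      rw [integral_sub (integrable_finsetSum _ fun i _ => hji i) (integrable_const _),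
        integral_finsetSum _ fun i _ => hji i]
      simp [hmean]
    rw [hlin]
    refine integral_mono ((integrable_finsetSum _ fun i _ => hji i).sub (integrable_const _))
      (integrable_of_abs_le ((hQm 1).comp measurable_prodMk_left) fun D' => hQb _ _) fun D' => ?_
    have hle := le_ciSup (hQbdd 1 (D, D')) j
    rw [← hQeq] at hle
    simpa using hle
  have hsign : ∀ ξ, ∫ p, Q 1 p ∂(μ.prod μ) = ∫ p, Q ξ p ∂(μ.prod μ) := fun ξ => by
    have hmp := measurePreserving_exchange ρ ξ
    conv_lhs => rw [hμ, ← hmp.map_eq]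
    rw [integral_map hmp.measurable.aemeasurable (hQm 1).aestronglyMeasurable]
    congr 1
    funext p
    refine iSup_congr fun j => Finset.sum_congr rfl fun i _ => ?_
    rcases Int.units_eq_one_or (ξ i) with hi | hi <;> simp [hi]
  have hsplit : ∀ ξ, ∫ p, Q ξ p ∂(μ.prod μ) ≤
      ∫ D, signedSup h ξ D ∂μ + ∫ D, signedSup h (-ξ) D ∂μ :=
    fun ξ => by
      have h1 : Integrable (fun p : (Fin n → Z) × (Fin n → Z) => signedSup h ξ p.2) (μ.prod μ) :=
        (hSi ξ).comp_snd μ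
      have h2 : Integrable (fun p : (Fin n → Z) × (Fin n → Z) => signedSup h (-ξ) p.1) (μ.prod μ) :=
        (hSi (-ξ)).comp_fst μ
      have h3 : ∫ p, (signedSup h ξ p.2 + signedSup h (-ξ) p.1) ∂(μ.prod μ)
          = ∫ D, signedSup h ξ D ∂μ + ∫ D, signedSup h (-ξ) D ∂μ := by
        rw [integral_add h1 h2, integral_fun_snd (fun D => signedSup h ξ D),
          integral_fun_fst (fun D => signedSup h (-ξ) D)]
        simp
      rw [← h3]
      refine integral_mono (hQi ξ) (h1.add h2) fun p => ?_
      change Q ξ p ≤ _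
      rw [hQeq]
      refine ciSup_le fun j => ?_
      have h4 := le_ciSup (bddAbove_signed_sum hM ξ p.2) j
      have h5 := le_ciSup (bddAbove_signed_sum hM (-ξ) p.1) j
      simp only [Pi.neg_apply, Units.val_neg, Int.cast_neg, neg_mul, Finset.sum_neg_distrib] at h5
      simp only [signedSup]
      simp only [Pi.neg_apply, Units.val_neg, Int.cast_neg, neg_mul, Finset.sum_neg_distrib]
      linarith
  have hR : ∫ D, rademacherSup h D ∂μ = 𝔼 ξ : Fin n → ℤˣ, ∫ D, signedSup h ξ D ∂μ := by
    simp only [rademacherSup, Fintype.expect_eq_sum_div_card]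
    rw [integral_div, integral_finsetSum _ fun ξ _ => hSi ξ]
  have hneg : 𝔼 ξ : Fin n → ℤˣ, ∫ D, signedSup h (-ξ) D ∂μ
      = 𝔼 ξ : Fin n → ℤˣ, ∫ D, signedSup h ξ D ∂μ :=
    Fintype.expect_equiv (Equiv.neg _) _ _ fun _ => rfl
  have havg := Finset.le_expect Finset.univ_nonempty
    fun ξ (_ : ξ ∈ Finset.univ) => (hghost.trans (hsign ξ).le).trans (hsplit ξ)
  rw [Finset.expect_add_distrib, hneg] at havg
  rw [hR, two_mul]
  exact havg

/-- Uniform deviation in terms of the empirical Rademacher average. McDiarmid's inequality is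
applied once, to `deviationSup - 2 * rademacherSup`, whose mean is nonpositive by symmetrization;
this is what makes the bound hold with `log (1 / δ)` for every `δ < 1`. -/
theorem exists_uniform_deviation_event [Countable J] [Nonempty J] (hh : ∀ j, Measurable (h j))
    (hM : ∀ j z, |h j z| ≤ M) {δ : ℝ} (hδ : 0 < δ) (hδ1 : δ < 1) :
    ∃ A : Set (Fin n → Z), MeasurableSet A ∧
      ENNReal.ofReal (1 - δ) ≤ Measure.pi (fun _ : Fin n => ρ) A ∧
      ∀ D ∈ A, ∀ j, n * ∫ z, h j z ∂ρ - ∑ i, h j (D i) ≤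
        2 * rademacherSup h D + 3 * √2 * M * √(n * Real.log (1 / δ)) := by
  set μ : Measure (Fin n → Z) := Measure.pi fun _ => ρ with hμ
  have : Nonempty Z := nonempty_of_isProbabilityMeasure ρ
  obtain ⟨z₀⟩ := ‹Nonempty Z›
  obtain ⟨j₀⟩ := id ‹Nonempty J›
  have hM0 : 0 ≤ M := (abs_nonneg _).trans (hM j₀ z₀)
  have hlog : 0 < Real.log (1 / δ) := Real.log_pos (by rw [lt_div_iff₀ hδ]; linarith)
  -- The differences of `Φ` below are at most `6 M`, so its tail is `exp (-t² / (18 n M²))`, which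
  -- equals `δ` for this `t`.
  set t : ℝ := 3 * √2 * M * √(n * Real.log (1 / δ)) with ht
  have ht0 : 0 ≤ t := by positivity
  let Φ : (Fin n → Z) → ℝ := fun D => deviationSup ρ h D - 2 * rademacherSup h D
  have hΦm : Measurable Φ :=
    (measurable_deviationSup hh).sub ((measurable_rademacherSup hh).const_mul 2)
  refine ⟨{D | Φ D ≤ t}, measurableSet_le hΦm measurable_const, ?_, fun D hD j => ?_⟩
  swap
  · have h1 := le_ciSup (bddAbove_deviation (ρ := ρ) hM D) j
    have h2 : deviationSup ρ h D - 2 * rademacherSup h D ≤ t := hD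
    rw [deviationSup] at h2
    linarith
  -- If `n * M = 0` the sub-Gaussian tail bound degenerates, but then `Φ` vanishes identically.
  rcases (by positivity : (0 : ℝ) ≤ n * M).eq_or_lt with hnM | hnM
  · have hall : {D | Φ D ≤ t} = Set.univ := Set.eq_univ_of_forall fun D => by
      have h1 := abs_le.mp (abs_deviationSup_le (ρ := ρ) hM D)
      have h2 := abs_le.mp (abs_rademacherSup_le hM D)
      rw [← hnM] at h1 h2
      change deviationSup ρ h D - 2 * rademacherSup h D ≤ t
      linarith [h1.2, h2.1]
    rw [hall, measure_univ]
    exact ENNReal.ofReal_le_one.mpr (by linarith)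
  have hΦb : ∀ D, |Φ D| ≤ 4 * (n * M) := fun D => by
    have h1 := abs_le.mp (abs_deviationSup_le (ρ := ρ) hM D)
    have h2 := abs_le.mp (abs_rademacherSup_le hM D)
    exact abs_le.mpr ⟨by simp only [Φ]; linarith, by simp only [Φ]; linarith⟩
  obtain ⟨c, hcM⟩ : ∃ c : ℝ≥0, (c : ℝ) = 6 * M := ⟨⟨6 * M, by positivity⟩, rfl⟩
  have hΦc : ∀ D i z, |Φ (Function.update D i z) - Φ D| ≤ c :=
    fun D i z => by
      have h1 := abs_le.mp (abs_deviationSup_update_sub_le (ρ := ρ) hM D i z)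
      have h2 := abs_le.mp (abs_rademacherSup_update_sub_le hM D i z)
      exact abs_le.mpr ⟨by simp only [Φ]; linarith, by simp only [Φ]; linarith⟩
  have hmean : ∫ D, Φ D ∂μ ≤ 0 := by
    simp only [Φ]
    rw [integral_sub (integrable_of_abs_le (measurable_deviationSup hh) (abs_deviationSup_le hM))
      ((integrable_of_abs_le (measurable_rademacherSup hh) (abs_rademacherSup_le hM)).const_mul 2),
      integral_const_mul]
    linarith [integral_deviationSup_le (n := n) (ρ := ρ) hh hM]
  have htail := (hasSubgaussianMGF_of_bounded_differences ρ hΦm hΦb hΦc).measure_ge_le ht0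
  have hexp : Real.exp (-t ^ 2 / (2 * ((n * (c / 2) ^ 2 : ℝ≥0) : ℝ)))
      = δ := by
    have hne : (n : ℝ) * M ≠ 0 := hnM.ne'
    have hn : (n : ℝ) ≠ 0 := left_ne_zero_of_mul hne
    have hMne : M ≠ 0 := right_ne_zero_of_mul hne
    have h1 : -t ^ 2 / (2 * ((n * (c / 2) ^ 2 : ℝ≥0) : ℝ))
        = Real.log δ := by
      have ht2 : t ^ 2 = 18 * M ^ 2 * (n * Real.log (1 / δ)) := by
        rw [ht, mul_pow, mul_pow, mul_pow, Real.sq_sqrt (by norm_num), Real.sq_sqrt (by positivity)]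
        ring
      rw [ht2, one_div, Real.log_inv]
      push_cast
      rw [hcM]
      field_simp
      ring
    rw [h1, Real.exp_log hδ]
  rw [hexp] at htail
  have hsub : {D | Φ D ≤ t}ᶜ ⊆ {D | t ≤ Φ D - ∫ D', Φ D' ∂μ} := fun D hD => by
    have h1 : t < Φ D := not_le.mp hD
    change t ≤ Φ D - ∫ D', Φ D' ∂μ
    linarith
  have hcompl : μ.real {D | Φ D ≤ t}ᶜ ≤ δ := (measureReal_mono hsub).trans htail
  rw [probReal_compl_eq_one_sub (measurableSet_le hΦm measurable_const)] at hcompl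
  rw [← ENNReal.ofReal_toReal (measure_ne_top μ _)]
  refine ENNReal.ofReal_le_ofReal ?_
  change 1 - δ ≤ μ.real _
  linarith

end Symmetrization

/-! ### The hypothesis space -/

section HypothesisSpace

open Filter Topology

variable {X H : Type*} [NormedAddCommGroup H] [InnerProductSpace ℝ H] {K : ℕ} {φ : X → H}
  {𝒲 : Set (Fin K → H)}

/-- The hypothesis space is separable for pointwise convergence, although neither `H` nor `𝒲` need
be: an estimator depends only on the projection of its weight to the closed span of the range of
`φ`, which is separable. -/
lemma exists_countable_pointwise_dense [CompleteSpace H]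
    (hφ : TopologicalSpace.IsSeparable (Set.range φ)) :
    ∃ 𝒞 ⊆ hypothesisSpace φ 𝒲, 𝒞.Countable ∧ ∀ f ∈ hypothesisSpace φ 𝒲,
      ∃ u : ℕ → X → EuclideanSpace ℝ (Fin K), (∀ m, u m ∈ 𝒞) ∧
        ∀ x, Tendsto (fun m => u m x) atTop (𝓝 (f x)) := by
  set V : Submodule ℝ H := (Submodule.span ℝ (Set.range φ)).topologicalClosure with hV
  have hVc : CompleteSpace V :=
    (Submodule.isClosed_topologicalClosure _).completeSpace_coe
  have hVsep : TopologicalSpace.SeparableSpace V :=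
    (hφ.span (R := ℝ)).closure.separableSpace
  have hmem : ∀ x, φ x ∈ V := fun x =>
    Submodule.le_topologicalClosure _ (Submodule.subset_span ⟨x, rfl⟩)
  let p : (Fin K → H) → Fin K → V := fun W k => V.orthogonalProjectionOnto (W k)
  let E : (Fin K → V) → X → EuclideanSpace ℝ (Fin K) :=
    fun w => linearEstimator φ fun k => (w k : H)
  have hE : ∀ W, E (p W) = linearEstimator φ W := fun W => by
    funext x
    ext k
    have h := Submodule.inner_orthogonalProjectionOnto_eq_of_mem_right (⟨φ x, hmem x⟩ : V) (W k)
    exact h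
  have hEc : ∀ x, Continuous fun w => E w x := fun x => by
    refine (PiLp.continuous_toLp 2 _).comp (continuous_pi fun k => ?_)
    fun_prop
  obtain ⟨T, hTsub, hTc, hTd⟩ :=
    (TopologicalSpace.IsSeparable.of_separableSpace (p '' 𝒲)).exists_countable_dense_subset
  refine ⟨E '' T, ?_, hTc.image E, ?_⟩
  · rintro _ ⟨w, hw, rfl⟩
    obtain ⟨W, hW, rfl⟩ := hTsub hw
    exact ⟨W, hW, (hE W).symm⟩
  · rintro _ ⟨W, hW, rfl⟩
    obtain ⟨w, hwT, hw⟩ := mem_closure_iff_seq_limit.mp (hTd ⟨W, hW, rfl⟩)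
    refine ⟨fun m => E (w m), fun m => ⟨w m, hwT m, rfl⟩, fun x => ?_⟩
    rw [← hE W]
    exact ((hEc x).tendsto _).comp hw

lemma measurable_of_mem_hypothesisSpace [MeasurableSpace X] (hφ : StronglyMeasurable φ)
    {f : X → EuclideanSpace ℝ (Fin K)} (hf : f ∈ hypothesisSpace φ 𝒲) : Measurable f := by
  obtain ⟨W, -, rfl⟩ := hf
  refine (PiLp.continuous_toLp 2 _).measurable.comp (measurable_pi_lambda _ fun k => ?_)
  exact (stronglyMeasurable_const.inner hφ).measurable

lemma bddAbove_sign_sum (hB : BddAbove (traceNorm '' 𝒲)) {n : ℕ} (x : Fin n → X)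
    (ξ : Fin n → Fin K → ℤˣ) :
    BddAbove (Set.range fun f : hypothesisSpace φ 𝒲 =>
      ∑ i, ∑ k, ((ξ i k : ℤ) : ℝ) * f.1 (x i) k) := by
  refine ⟨∑ i, K * (weightBound 𝒲 * ‖φ (x i)‖), ?_⟩
  rintro _ ⟨f, rfl⟩
  refine Finset.sum_le_sum fun i _ =>
    (le_abs_self _).trans ((abs_sum_sign_mul_le (ξ i) (f.1 (x i))).trans ?_)
  rw [Fintype.card_fin]
  exact mul_le_mul_of_nonneg_left (norm_hypothesisSpace_le hB f.2 (x i)) (Nat.cast_nonneg K)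

/-- The Rademacher complexity is nonnegative: the suprema at `ξ` and `-ξ` have nonnegative sum. -/
lemma empiricalRademacher_nonneg (h𝒲 : 𝒲.Nonempty) (hB : BddAbove (traceNorm '' 𝒲)) {n : ℕ}
    (x : Fin n → X) : 0 ≤ empiricalRademacher (hypothesisSpace φ 𝒲) x := by
  obtain ⟨W₀, hW₀⟩ := h𝒲
  let f₀ : hypothesisSpace φ 𝒲 := ⟨_, W₀, hW₀, rfl⟩
  set T : (Fin n → Fin K → ℤˣ) → ℝ :=
    fun ξ => ⨆ f : hypothesisSpace φ 𝒲, ∑ i, ∑ k, ((ξ i k : ℤ) : ℝ) * f.1 (x i) k with hT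
  have hneg : 𝔼 ξ, T (-ξ) = 𝔼 ξ, T ξ :=
    Fintype.expect_equiv (Equiv.neg _) _ _ fun _ => rfl
  have hsum : 0 ≤ 𝔼 ξ, (T ξ + T (-ξ)) := Finset.expect_nonneg fun ξ _ => by
    have h1 := le_ciSup (bddAbove_sign_sum hB x ξ) f₀
    have h2 := le_ciSup (bddAbove_sign_sum hB x (-ξ)) f₀
    simp only [Pi.neg_apply, Units.val_neg, Int.cast_neg, neg_mul, Finset.sum_neg_distrib] at h2
    simp only [hT, Pi.neg_apply, Units.val_neg, Int.cast_neg, neg_mul, Finset.sum_neg_distrib]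
    linarith
  rw [Finset.expect_add_distrib, hneg] at hsum
  exact mul_nonneg (by positivity) (by linarith : (0 : ℝ) ≤ 𝔼 ξ, T ξ)

/-- Contraction for the losses along a subfamily of the hypothesis space. Subtracting the loss of a
fixed `g` does not affect the Lipschitz condition. -/
lemma rademacherSup_loss_le {Y : Type*} (hB : BddAbove (traceNorm '' 𝒲))
    {𝒞 : Set (X → EuclideanSpace ℝ (Fin K))} (h𝒞 : 𝒞 ⊆ hypothesisSpace φ 𝒲) (hne : 𝒞.Nonempty)
    {ℓ : EuclideanSpace ℝ (Fin K) → Y → ℝ} {L : ℝ≥0} (hℓ : ∀ y, LipschitzWith L fun u => ℓ u y)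
    (g : X → EuclideanSpace ℝ (Fin K)) {h : 𝒞 → X × Y → ℝ} {M : ℝ} (hM : ∀ j z, |h j z| ≤ M)
    {n : ℕ} (hn : 0 < n) {D : Fin n → X × Y}
    (hD : ∀ j i, h j (D i) = ℓ (j.1 (D i).1) (D i).2 - ℓ (g (D i).1) (D i).2) :
    rademacherSup h D ≤
      √2 * L * (n * empiricalRademacher (hypothesisSpace φ 𝒲) fun i => (D i).1) := by
  have : Nonempty 𝒞 := hne.to_subtype
  have h1 := expect_iSup_le_vector_contraction (S := 𝒞) (L := (L : ℝ)) L.2 (F := fun _ => 0)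
    (ψ := fun i j => h j (D i)) (u := fun i j => j.1 (D i).1)
    (fun i s t => by
      rw [hD, hD, sub_sub_sub_cancel_right, ← Real.dist_eq, ← dist_eq_norm]
      exact (hℓ _).dist_le_mul _ _)
    (fun _ => le_refl (0 : ℝ)) (fun i j => hM j (D i))
    (fun i j => norm_hypothesisSpace_le hB (h𝒞 j.2) (D i).1)
  simp only [zero_add] at h1
  refine h1.trans ?_
  have hn' : (n : ℝ) ≠ 0 := by positivity
  rw [empiricalRademacher, ← mul_assoc (n : ℝ), mul_one_div_cancel hn', one_mul, Finset.mul_expect]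
  refine Finset.expect_le_expect fun ξ _ => ?_
  rw [← Real.mul_iSup_of_nonneg (by positivity)]
  refine mul_le_mul_of_nonneg_left (ciSup_le fun j => ?_) (by positivity)
  exact le_ciSup (bddAbove_sign_sum hB (fun i => (D i).1) ξ) ⟨j.1, h𝒞 j.2⟩

end HypothesisSpace

/-! ### Excess risk -/

section ExcessRisk

open Filter Topology

variable {X Y H : Type*} [MeasurableSpace X] [MeasurableSpace Y] [NormedAddCommGroup H]
  [InnerProductSpace ℝ H] [CompleteSpace H] {K : ℕ} {φ : X → H} {𝒲 : Set (Fin K → H)}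

/-- The uniform deviation bound is applied to the excess losses over `fstar` along a countable
pointwise dense subfamily, set to zero on a null set so that they are bounded by `M` everywhere;
the empirical minimizer is reached by dominated convergence. -/
theorem exists_excessRisk_event (hφ : StronglyMeasurable φ)
    (hB : BddAbove (traceNorm '' 𝒲)) (ρ : Measure (X × Y)) [IsProbabilityMeasure ρ]
    {ℓ : EuclideanSpace ℝ (Fin K) → Y → ℝ} {L : ℝ≥0} {M : ℝ}
    {fstar : X → EuclideanSpace ℝ (Fin K)} (hℓm : Measurable (Function.uncurry ℓ))
    (hℓ : ∀ y, LipschitzWith L fun u => ℓ u y)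
    (hint : ∀ f ∈ hypothesisSpace φ 𝒲, Integrable (fun z : X × Y => ℓ (f z.1) z.2) ρ)
    (hbdd : ∀ᵐ z ∂ρ, ∀ f ∈ hypothesisSpace φ 𝒲, ∀ g ∈ hypothesisSpace φ 𝒲,
      |ℓ (f z.1) z.2 - ℓ (g z.1) z.2| ≤ M)
    (hfstar : fstar ∈ hypothesisSpace φ 𝒲) {n : ℕ} (hn : 0 < n) {δ : ℝ} (hδ : 0 < δ)
    (hδ1 : δ < 1) :
    ∃ A : Set (Fin n → X × Y), MeasurableSet A ∧
      ENNReal.ofReal (1 - δ) ≤ Measure.pi (fun _ : Fin n => ρ) A ∧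
      ∀ D ∈ A, ∀ fhat : X → EuclideanSpace ℝ (Fin K),
        IsMinimizer (empiricalLoss ℓ D) (hypothesisSpace φ 𝒲) fhat →
        expectedLoss ℓ ρ fhat - expectedLoss ℓ ρ fstar ≤
          2 * √2 * L * empiricalRademacher (hypothesisSpace φ 𝒲) (fun i => (D i).1)
            + 3 * √2 * M * √(Real.log (1 / δ) / n) := by
  have hn' : (0 : ℝ) < n := by exact_mod_cast hn
  obtain ⟨N, hNsub, hNm, hN0⟩ := exists_measurable_superset_of_null hbdd
  have hN : ∀ z ∉ N, ∀ f ∈ hypothesisSpace φ 𝒲, ∀ g ∈ hypothesisSpace φ 𝒲,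
      |ℓ (f z.1) z.2 - ℓ (g z.1) z.2| ≤ M := fun z hz => by
    by_contra hcon
    exact hz (hNsub hcon)
  have hNc : ρ Nᶜ = 1 := (prob_compl_eq_one_iff hNm).mpr hN0
  have hM0 : 0 ≤ M := by
    obtain ⟨z, hz⟩ := nonempty_of_measure_ne_zero (μ := ρ) (s := Nᶜ)
      (by rw [hNc]; exact one_ne_zero)
    exact (abs_nonneg _).trans (hN z hz fstar hfstar fstar hfstar)
  obtain ⟨𝒞, h𝒞, h𝒞c, h𝒞d⟩ := exists_countable_pointwise_dense (𝒲 := 𝒲) hφ.isSeparable_range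
  have h𝒞ne : 𝒞.Nonempty := by
    obtain ⟨u, hu, -⟩ := h𝒞d fstar hfstar
    exact ⟨_, hu 0⟩
  have : Nonempty 𝒞 := h𝒞ne.to_subtype
  have : Countable 𝒞 := h𝒞c.to_subtype
  let e : (X → EuclideanSpace ℝ (Fin K)) → X × Y → ℝ :=
    fun f => Nᶜ.indicator fun z => ℓ (f z.1) z.2 - ℓ (fstar z.1) z.2
  have he : ∀ f, ∀ z ∉ N, e f z = ℓ (f z.1) z.2 - ℓ (fstar z.1) z.2 :=
    fun f z hz => Set.indicator_of_mem hz _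
  have heM : ∀ f ∈ hypothesisSpace φ 𝒲, ∀ z, |e f z| ≤ M := fun f hf z => by
    by_cases hz : z ∈ N
    · simpa [e, hz] using hM0
    · rw [he f z hz]
      exact hN z hz f hf fstar hfstar
  have hlossm : ∀ f ∈ hypothesisSpace φ 𝒲, Measurable fun z : X × Y => ℓ (f z.1) z.2 :=
    fun f hf => hℓm.comp
      (((measurable_of_mem_hypothesisSpace hφ hf).comp measurable_fst).prodMk measurable_snd)
  have hem : ∀ f ∈ hypothesisSpace φ 𝒲, Measurable (e f) := fun f hf =>
    ((hlossm f hf).sub (hlossm fstar hfstar)).indicator hNm.compl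
  have heint : ∀ f ∈ hypothesisSpace φ 𝒲,
      ∫ z, e f z ∂ρ = expectedLoss ℓ ρ f - expectedLoss ℓ ρ fstar := fun f hf => by
    rw [expectedLoss, expectedLoss, ← integral_sub (hint f hf) (hint fstar hfstar)]
    refine integral_congr_ae ?_
    filter_upwards [measure_eq_zero_iff_ae_notMem.mp hN0] with z hz using he f z hz
  obtain ⟨A, hAm, hAμ, hA⟩ := exists_uniform_deviation_event (n := n) (ρ := ρ)
    (h := fun j : 𝒞 => e j.1) (fun j => hem j.1 (h𝒞 j.2)) (fun j => heM j.1 (h𝒞 j.2)) hδ hδ1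
  have hgood : Measure.pi (fun _ : Fin n => ρ) (Set.univ.pi fun _ => Nᶜ)ᶜ = 0 := by
    rw [prob_compl_eq_zero_iff (MeasurableSet.univ_pi fun _ => hNm.compl), Measure.pi_pi]
    simp [hNc]
  refine ⟨A ∩ Set.univ.pi fun _ => Nᶜ, hAm.inter (MeasurableSet.univ_pi fun _ => hNm.compl), ?_, ?_⟩
  · rwa [measure_inter_conull hgood]
  rintro D ⟨hDA, hDN⟩ fhat ⟨hfhat, hmin⟩
  have hDN' : ∀ i, D i ∉ N := fun i => hDN i (Set.mem_univ i)
  obtain ⟨u, hu, hulim⟩ := h𝒞d fhat hfhat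
  have hlim : ∀ z, Tendsto (fun m => e (u m) z) atTop (𝓝 (e fhat z)) := fun z => by
    by_cases hz : z ∈ N
    · simp [e, hz]
    · simp only [he _ z hz]
      exact (((hℓ z.2).continuous.tendsto _).comp (hulim z.1)).sub_const _
  have hlimint : Tendsto (fun m => ∫ z, e (u m) z ∂ρ) atTop (𝓝 (∫ z, e fhat z ∂ρ)) :=
    tendsto_integral_of_dominated_convergence (fun _ => M)
      (fun m => (hem _ (h𝒞 (hu m))).aestronglyMeasurable) (integrable_const _)
      (fun m => .of_forall fun z => heM _ (h𝒞 (hu m)) z) (.of_forall hlim)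
  have hdev : n * ∫ z, e fhat z ∂ρ - ∑ i, e fhat (D i) ≤
      2 * rademacherSup (fun j : 𝒞 => e j.1) D + 3 * √2 * M * √(n * Real.log (1 / δ)) :=
    le_of_tendsto ((hlimint.const_mul _).sub (tendsto_finsetSum _ fun i _ => hlim (D i)))
      (.of_forall fun m => hA D hDA ⟨u m, hu m⟩)
  have hemp : ∑ i, e fhat (D i) ≤ 0 := by
    simp only [fun i => he fhat (D i) (hDN' i), Finset.sum_sub_distrib]
    have h1 := hmin fstar hfstar
    rw [empiricalLoss, empiricalLoss] at h1
    linarith [le_of_mul_le_mul_left h1 (by positivity)]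
  have hrad := rademacherSup_loss_le hB h𝒞 h𝒞ne hℓ fstar (h := fun j : 𝒞 => e j.1)
    (fun j => heM j.1 (h𝒞 j.2)) hn fun j i => he j.1 (D i) (hDN' i)
  rw [heint fhat hfhat] at hdev
  have hsqrt : √(n * Real.log (1 / δ)) = n * √(Real.log (1 / δ) / n) := by
    rw [show n * Real.log (1 / δ) = (n : ℝ) ^ 2 * (Real.log (1 / δ) / n) by field_simp,
      Real.sqrt_mul (sq_nonneg _), Real.sqrt_sq hn'.le]
  rw [hsqrt] at hdev
  refine le_of_mul_le_mul_left ?_ hn'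
  linarith

end ExcessRisk

theorem mainTheorem3 :
    ∃ C : ℝ, 0 < C ∧
      ∀ (X Y H : Type*) [MeasurableSpace X] [MeasurableSpace Y]
        [NormedAddCommGroup H] [InnerProductSpace ℝ H] [CompleteSpace H]
        (K : ℕ) (φ : X → H) (κ : X → X → ℝ) (𝒲 : Set (Fin K → H)),
        StronglyMeasurable φ →
        (∀ x x', κ x x' = inner ℝ (φ x) (φ x')) →
        𝒲.Nonempty →
        BddAbove (traceNorm '' 𝒲) →
        -- the excess risk bound
        (∀ (ρ : Measure (X × Y)) [IsProbabilityMeasure ρ]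
            (ℓ : EuclideanSpace ℝ (Fin K) → Y → ℝ) (L : ℝ≥0) (M : ℝ)
            (fstar : X → EuclideanSpace ℝ (Fin K)),
            Measurable (Function.uncurry ℓ) →
            (∀ y, LipschitzWith L (fun u => ℓ u y)) →
            (∀ f ∈ hypothesisSpace φ 𝒲, Integrable (fun z : X × Y => ℓ (f z.1) z.2) ρ) →
            (∀ᵐ z ∂ρ, ∀ f ∈ hypothesisSpace φ 𝒲, ∀ g ∈ hypothesisSpace φ 𝒲,
              |ℓ (f z.1) z.2 - ℓ (g z.1) z.2| ≤ M) →
            IsMinimizer (expectedLoss ℓ ρ) (hypothesisSpace φ 𝒲) fstar →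
            ∀ (n : ℕ) (δ : ℝ), 0 < n → 0 < δ → δ < 1 →
              ∃ A : Set (Fin n → X × Y), MeasurableSet A ∧
                ENNReal.ofReal (1 - δ) ≤ Measure.pi (fun _ : Fin n => ρ) A ∧
                ∀ D ∈ A, ∀ fhat : X → EuclideanSpace ℝ (Fin K),
                  IsMinimizer (empiricalLoss ℓ D) (hypothesisSpace φ 𝒲) fhat →
                  expectedLoss ℓ ρ fhat - expectedLoss ℓ ρ fstar ≤
                    4 * Real.sqrt 2 * L *
                        empiricalRademacher (hypothesisSpace φ 𝒲) (fun i => (D i).1)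
                      + C * M * Real.sqrt (Real.log (1 / δ) / n)) ∧
        -- the bound on the empirical Rademacher complexity, for every sample of inputs
        (∀ (n : ℕ) (x : Fin n → X), 0 < n →
            empiricalRademacher (hypothesisSpace φ 𝒲) x ≤
              weightBound 𝒲 / n * Real.sqrt (K * ∑ i, κ (x i) (x i))) := by
  refine ⟨3 * √2, by positivity, ?_⟩
  intro X Y H _ _ _ _ _ K φ κ 𝒲 hφ hκ h𝒲 hB
  refine ⟨?_, fun n x _ => ?_⟩
  · intro ρ _ ℓ L M fstar hℓm hℓ hint hbdd hfstar n δ hn hδ hδ1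
    obtain ⟨A, hAm, hAμ, hA⟩ :=
      exists_excessRisk_event hφ hB ρ hℓm hℓ hint hbdd hfstar.1 hn hδ hδ1
    refine ⟨A, hAm, hAμ, fun D hD fhat hfhat => (hA D hD fhat hfhat).trans ?_⟩
    have hR := empiricalRademacher_nonneg (φ := φ) h𝒲 hB fun i => (D i).1
    have hR' : 0 ≤ 2 * √2 * L * empiricalRademacher (hypothesisSpace φ 𝒲) fun i => (D i).1 := by
      positivity
    linarith
  · simp only [hκ, real_inner_self_eq_norm_sq]
    exact empiricalRademacher_hypothesisSpace_le h𝒲 hB x
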